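/- **Setting.** There are $n$ products with intrinsic utilities $u_1\ge u_2\ge\dots\ge u_n$ (real numbers), an outside option of attractiveness $a_0>0$, and a threshold $t>0$. A product of intrinsic utility $u_i$ sold at price $p_i$ has attractiveness $\exp(u_i-p_i)$, and product $i$ dominates product $j$ when $\exp(u_i-p_i)>(1+t)\exp(u_j-p_j)$. For $1\le k\le n$ let $S_k=\{1,\dots,k\}$ be the set of the $k$ products of highest intrinsic utility. The joint $k$-assortment and pricing problem under the Threshold Luce model (JAPTLM-$k$) is $$\max_{p\in\mathbb R^k}\; R^{(k)}(p)=\frac{\sum_{i=1}^k p_i\exp(u_i-p_i)}{\sum_{i=1}^k\exp(u_i-p_i)+a_0}\quad\text{subject to}\quad \exp(u_i-p_i)-(1+t)\exp(u_j-p_j)\le 0\ \text{ for all } 1\le i<j\le k .$$ **Model of computation.** Programs run on a real random-access machine: a single finite program, independent of the instance, acts on natural-number registers (constants, addition, truncated subtraction, comparison, use as array indices) and on arrays of real numbers with indirect addressing (conversion of natural numbers to reals, $+,-,\times,\div$, $\exp$, $\ln$, the Lambert function $W:[0,\infty)\to[0,\infty)$ defined by $W(x)e^{W(x)}=x$, and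 comparison), with conditionals and while-loops. Every elementary operation and test costs one step. **Theorem.** JAPTLM-$k$ can be solved in polynomial time. That is, there are one program and one polynomial $P$ such that for every $n$, all $u_1\ge\dots\ge u_n$, all $a_0>0$, $t>0$ and every $1\le k\le n$, the program, given $n,k,u,a_0,t$, halts after at most $P(k)$ steps and outputs an optimal solution $p\in\mathbb R^k$ of JAPTLM-$k$ (in particular, an optimal solution exists) together with the optimal revenue $R^{(k)}(p)$. -/

import Mathlib

namespace ThresholdLuce

/-! ### The pricing problem for the `k` products of highest intrinsic utility -/

/-- Attractiveness of a product of intrinsic utility `u` sold at price `p`. -/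
noncomputable def attractiveness (u p : ℝ) : ℝ := Real.exp (u - p)

/-- Expected revenue of the assortment `{0, …, k - 1}` at prices `p`, when no product is dominated;
`a₀` is the attractiveness of the outside option. -/
noncomputable def revenue {k : ℕ} (u : Fin k → ℝ) (a₀ : ℝ) (p : Fin k → ℝ) : ℝ :=
  (∑ i, p i * attractiveness (u i) (p i)) / (∑ i, attractiveness (u i) (p i) + a₀)

/-- The constraints `g_{ij}(p) ≤ 0` for `i < j`, where
`g_{ij}(p) = exp (u_i - p_i) - (1 + t) exp (u_j - p_j)`. -/
def Feasible {k : ℕ} (u : Fin k → ℝ) (t : ℝ) (p : Fin k → ℝ) : Prop :=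
  ∀ i j : Fin k, i < j →
    attractiveness (u i) (p i) - (1 + t) * attractiveness (u j) (p j) ≤ 0

/-- `p` is a solution of: maximize `revenue u a₀ p` over `p ∈ ℝ^k` subject to `Feasible u t p`. -/
def IsOptimalPricing {k : ℕ} (u : Fin k → ℝ) (a₀ t : ℝ) (p : Fin k → ℝ) : Prop :=
  Feasible u t p ∧ ∀ q : Fin k → ℝ, Feasible u t q → revenue u a₀ q ≤ revenue u a₀ p

/-! ### The Lambert function on `[0, ∞)` -/

open Classical in
/-- The Lambert function: for `x ≥ 0`, `lambertW x` is the unique `w ≥ 0` with `w * exp w = x`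
(see `lambertW_spec` and `lambertW_unique`); for `x < 0` it is `0`. -/
noncomputable def lambertW (x : ℝ) : ℝ :=
  if h : ∃ w : ℝ, 0 ≤ w ∧ w * Real.exp w = x then h.choose else 0

theorem exists_lambert {x : ℝ} (hx : 0 ≤ x) : ∃ w : ℝ, 0 ≤ w ∧ w * Real.exp w = x := by
  have hc : ContinuousOn (fun w : ℝ => w * Real.exp w) (Set.Icc 0 x) := by fun_prop
  have hm : x ∈ Set.Icc ((fun w : ℝ => w * Real.exp w) 0) ((fun w : ℝ => w * Real.exp w) x) := by
    refine ⟨by simpa using hx, ?_⟩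
    have := Real.one_le_exp hx
    simp only
    nlinarith
  obtain ⟨w, hw, h⟩ := intermediate_value_Icc hx hc hm
  exact ⟨w, hw.1, h⟩

theorem lambertW_spec {x : ℝ} (hx : 0 ≤ x) :
    0 ≤ lambertW x ∧ lambertW x * Real.exp (lambertW x) = x := by
  have h := exists_lambert hx
  rw [lambertW, dif_pos h]
  exact h.choose_spec

theorem lambertW_unique {x w : ℝ} (hw : 0 ≤ w) (h : w * Real.exp w = x) : lambertW x = w := by
  have hx : 0 ≤ x := h ▸ mul_nonneg hw (Real.exp_pos w).le
  obtain ⟨h0, h1⟩ := lambertW_spec hx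
  have key : ∀ a b : ℝ, 0 ≤ a → a < b → a * Real.exp a < b * Real.exp b := fun a b ha hab =>
    mul_lt_mul hab (Real.exp_le_exp.2 hab.le) (Real.exp_pos a) (ha.trans hab.le)
  rcases lt_trichotomy (lambertW x) w with hlt | heq | hgt
  · have := key _ _ h0 hlt
    linarith
  · exact heq
  · have := key _ _ hw hgt
    linarith

/-! ### A real random-access machine with unit-cost operations

A single finite program, written in a structured imperative language, works on a memory of
natural-number registers (used for counting and for addresses) and of real arrays with indirect
addressing. Each elementary operation and test costs one step. -/

/-- Memory: `idx x` is the natural-number register `x`, `arr a i` is cell `i` of the array `a`. -/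
structure Memory where
  idx : ℕ → ℕ
  arr : ℕ → ℕ → ℝ

/-- Expressions over the natural-number registers; subtraction is truncated. -/
inductive IdxExpr where
  | const (n : ℕ)
  | reg (x : ℕ)
  | add (e₁ e₂ : IdxExpr)
  | sub (e₁ e₂ : IdxExpr)

namespace IdxExpr

def eval (m : Memory) : IdxExpr → ℕ
  | const n => n
  | reg x => m.idx x
  | add e₁ e₂ => e₁.eval m + e₂.eval m
  | sub e₁ e₂ => e₁.eval m - e₂.eval m

/-- Number of steps needed to evaluate the expression. -/
def cost : IdxExpr → ℕ
  | const _ => 1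
  | reg _ => 1
  | add e₁ e₂ => e₁.cost + e₂.cost + 1
  | sub e₁ e₂ => e₁.cost + e₂.cost + 1

end IdxExpr

/-- Real expressions: conversion of a natural number, an array cell (the array is named in the
program, the cell is addressed indirectly), the four field operations, `exp`, `ln` and the Lambert
function. Outside their natural domains the operations take the values `x / 0 = 0`,
`ln x = ln |x|`, `ln 0 = 0` and `W x = 0` for `x < 0`; a program can test for these cases. -/
inductive RealExpr where
  | ofIdx (e : IdxExpr)
  | cell (a : ℕ) (e : IdxExpr)
  | add (r₁ r₂ : RealExpr)
  | sub (r₁ r₂ : RealExpr)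
  | mul (r₁ r₂ : RealExpr)
  | div (r₁ r₂ : RealExpr)
  | exp (r : RealExpr)
  | ln (r : RealExpr)
  | lambert (r : RealExpr)

namespace RealExpr

noncomputable def eval (m : Memory) : RealExpr → ℝ
  | ofIdx e => (e.eval m : ℝ)
  | cell a e => m.arr a (e.eval m)
  | add r₁ r₂ => r₁.eval m + r₂.eval m
  | sub r₁ r₂ => r₁.eval m - r₂.eval m
  | mul r₁ r₂ => r₁.eval m * r₂.eval m
  | div r₁ r₂ => r₁.eval m / r₂.eval m
  | exp r => Real.exp (r.eval m)
  | ln r => Real.log (r.eval m)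
  | lambert r => lambertW (r.eval m)

/-- Number of steps needed to evaluate the expression. -/
def cost : RealExpr → ℕ
  | ofIdx e => e.cost + 1
  | cell _ e => e.cost + 1
  | add r₁ r₂ => r₁.cost + r₂.cost + 1
  | sub r₁ r₂ => r₁.cost + r₂.cost + 1
  | mul r₁ r₂ => r₁.cost + r₂.cost + 1
  | div r₁ r₂ => r₁.cost + r₂.cost + 1
  | exp r => r.cost + 1
  | ln r => r.cost + 1
  | lambert r => r.cost + 1

end RealExpr

/-- Tests. -/
inductive Test where
  | idxLe (e₁ e₂ : IdxExpr)
  | realLe (r₁ r₂ : RealExpr)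
  | neg (b : Test)
  | conj (b₁ b₂ : Test)

namespace Test

def Holds (m : Memory) : Test → Prop
  | idxLe e₁ e₂ => e₁.eval m ≤ e₂.eval m
  | realLe r₁ r₂ => r₁.eval m ≤ r₂.eval m
  | neg b => ¬ b.Holds m
  | conj b₁ b₂ => b₁.Holds m ∧ b₂.Holds m

/-- Number of steps needed to evaluate the test. -/
def cost : Test → ℕ
  | idxLe e₁ e₂ => e₁.cost + e₂.cost + 1
  | realLe r₁ r₂ => r₁.cost + r₂.cost + 1
  | neg b => b.cost + 1
  | conj b₁ b₂ => b₁.cost + b₂.cost + 1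

end Test

/-- Programs. -/
inductive Program where
  | skip
  | setIdx (x : ℕ) (e : IdxExpr)
  | setCell (a : ℕ) (e : IdxExpr) (r : RealExpr)
  | seq (c₁ c₂ : Program)
  | ite (b : Test) (c₁ c₂ : Program)
  | loop (b : Test) (c : Program)

namespace Memory

/-- Store `n` in the natural-number register `x`. -/
def setIdx (m : Memory) (x n : ℕ) : Memory :=
  { m with idx := Function.update m.idx x n }

/-- Store `r` in cell `i` of the array `a`. -/
def setCell (m : Memory) (a i : ℕ) (r : ℝ) : Memory :=
  { m with arr := Function.update m.arr a (Function.update (m.arr a) i r) }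

end Memory

/-- `Run c m m' T`: started on the memory `m`, the program `c` halts after exactly `T` steps with
the memory `m'`. (`loop b c` is "while `b` do `c`".) -/
inductive Run : Program → Memory → Memory → ℕ → Prop
  | skip (m : Memory) : Run .skip m m 1
  | setIdx (m : Memory) (x : ℕ) (e : IdxExpr) :
      Run (.setIdx x e) m (m.setIdx x (e.eval m)) (e.cost + 1)
  | setCell (m : Memory) (a : ℕ) (e : IdxExpr) (r : RealExpr) :
      Run (.setCell a e r) m (m.setCell a (e.eval m) (r.eval m)) (e.cost + r.cost + 1)
  | seq {c₁ c₂ : Program} {m m₁ m₂ : Memory} {T₁ T₂ : ℕ} :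
      Run c₁ m m₁ T₁ → Run c₂ m₁ m₂ T₂ → Run (.seq c₁ c₂) m m₂ (T₁ + T₂)
  | iteTrue {b : Test} {c₁ c₂ : Program} {m m' : Memory} {T : ℕ} :
      b.Holds m → Run c₁ m m' T → Run (.ite b c₁ c₂) m m' (b.cost + 1 + T)
  | iteFalse {b : Test} {c₁ c₂ : Program} {m m' : Memory} {T : ℕ} :
      ¬ b.Holds m → Run c₂ m m' T → Run (.ite b c₁ c₂) m m' (b.cost + 1 + T)
  | loopDone {b : Test} {c : Program} {m : Memory} :
      ¬ b.Holds m → Run (.loop b c) m m (b.cost + 1)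
  | loopStep {b : Test} {c : Program} {m m₁ m₂ : Memory} {T₁ T₂ : ℕ} :
      b.Holds m → Run c m m₁ T₁ → Run (.loop b c) m₁ m₂ T₂ →
        Run (.loop b c) m m₂ (b.cost + 1 + T₁ + T₂)

/-- The machine is deterministic: the final memory and the number of steps are determined by the
program and the initial memory. -/
theorem Run.deterministic {c : Program} {m m₁ m₂ : Memory} {T₁ T₂ : ℕ}
    (h₁ : Run c m m₁ T₁) (h₂ : Run c m m₂ T₂) : m₁ = m₂ ∧ T₁ = T₂ := by
  induction h₁ generalizing m₂ T₂ with
  | skip m => cases h₂; exact ⟨rfl, rfl⟩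
  | setIdx m x e => cases h₂; exact ⟨rfl, rfl⟩
  | setCell m a e r => cases h₂; exact ⟨rfl, rfl⟩
  | seq _ _ ih ih' =>
    cases h₂ with
    | seq h h' =>
      obtain ⟨rfl, rfl⟩ := ih h
      obtain ⟨rfl, rfl⟩ := ih' h'
      exact ⟨rfl, rfl⟩
  | iteTrue hb _ ih =>
    cases h₂ with
    | iteTrue _ h =>
      obtain ⟨rfl, rfl⟩ := ih h
      exact ⟨rfl, rfl⟩
    | iteFalse hb' _ => exact absurd hb hb'
  | iteFalse hb _ ih =>
    cases h₂ with
    | iteTrue hb' _ => exact absurd hb' hb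
    | iteFalse _ h =>
      obtain ⟨rfl, rfl⟩ := ih h
      exact ⟨rfl, rfl⟩
  | loopDone hb =>
    cases h₂ with
    | loopDone _ => exact ⟨rfl, rfl⟩
    | loopStep hb' _ _ => exact absurd hb' hb
  | loopStep hb _ _ ih ih' =>
    cases h₂ with
    | loopDone hb' => exact absurd hb hb'
    | loopStep _ h h' =>
      obtain ⟨rfl, rfl⟩ := ih h
      obtain ⟨rfl, rfl⟩ := ih' h'
      exact ⟨rfl, rfl⟩

/-! ### Input and output conventions -/

/-- Initial memory. Register `0` holds `k`, register `1` holds the number `n` of products, array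
`0` holds the intrinsic utilities, array `1` holds `a₀` and `t` in cells `0` and `1`; everything
else is `0`. -/
noncomputable def inputMemory {n : ℕ} (u : Fin n → ℝ) (a₀ t : ℝ) (k : ℕ) : Memory where
  idx := fun x => if x = 0 then k else if x = 1 then n else 0
  arr := fun a i =>
    if a = 0 then (if h : i < n then u ⟨i, h⟩ else 0)
    else if a = 1 then (if i = 0 then a₀ else if i = 1 then t else 0)
    else 0

/-- The price vector written by the program: cells `0, …, k - 1` of array `2`. -/
def outputPrices (m : Memory) (k : ℕ) : Fin k → ℝ := fun i => m.arr 2 i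

/-- The revenue written by the program: cell `0` of array `3`. -/
def outputRevenue (m : Memory) : ℝ := m.arr 3 0

end ThresholdLuce

namespace ThresholdLuce

/-! ### The optimal prices in closed form -/

/-! Let `L = log (1 + t)` and let `c_i` be the projection of `u_i` to a window `[y, y + L]`. An
optimal solution has `u_i - p_i = c_i - l - 1`, so `p_i = e_i + l + 1` with `e_i = u_i - c_i`.
Attractivenesses then differ by a factor of at most `1 + t`, so `p` is feasible. The window is
placed so that `∑ e_i exp c_i = 0`. After division by `exp y` this says that `balance` vanishes at
`y`, the weight `1 + t` being `exp (y + L) / exp y`. The level `l` solves `l * exp l = (∑ exp c_i) /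
(e * a₀)`, hence `∑ exp (u_i - p_i) = l * a₀`, and the revenue of `p` is exactly `l`.

Optimality is a duality argument. For feasible `q` put `z_i = exp (u_i - q_i)`. The inequality `1 +
s ≤ exp s` at `s = q_i - p_i` gives `q_i z_i ≤ z_i e_i + l z_i + exp (u_i - p_i)`. Summing, `∑ q_i
z_i ≤ ∑ z_i e_i + l (∑ z_i + a₀)`, and `∑ z_i e_i ≤ 0` by `sum_mul_excess_nonpos`, the only place
where the constraints on `q` enter. This is `isOptimalPricing_of_balanced`.

For the algorithm, `balance` is continuous, nonincreasing and piecewise linear, with breakpoints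
`u_i` and `u_i - L`. From the largest breakpoint with nonnegative value, one Newton step lands on a
zero (`balance_newton`). There are `2k` breakpoints and each evaluation takes `O(k)` steps, so the
whole program runs in `O(k²)`. -/

/-- `u` minus its projection to the interval `[y, y + L]` (for `0 ≤ L`). -/
noncomputable def excess (L y u : ℝ) : ℝ := max (u - L - y) 0 + min (u - y) 0

/-- The weighted sum of the excesses over `[y, y + log τ]`, those at the top with weight `τ`. -/
noncomputable def balance (τ L : ℝ) (u : ℕ → ℝ) (k : ℕ) (y : ℝ) : ℝ :=
  ∑ i ∈ Finset.range k, (τ * max (u i - L - y) 0 + min (u i - y) 0)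

open Classical in
/-- Minus the right derivative of `balance` at `y`. -/
noncomputable def balanceSlope (τ L : ℝ) (u : ℕ → ℝ) (k : ℕ) (y : ℝ) : ℝ :=
  ∑ i ∈ Finset.range k, ((if u i ≤ y then 1 else 0) + if u i - L ≤ y then 0 else τ)

theorem excess_cases {L : ℝ} (hL : 0 ≤ L) (y u : ℝ) :
    (y + L < u ∧ max (u - L - y) 0 = u - L - y ∧ min (u - y) 0 = 0) ∨
    (u < y ∧ max (u - L - y) 0 = 0 ∧ min (u - y) 0 = u - y) ∨
    (y ≤ u ∧ u ≤ y + L ∧ max (u - L - y) 0 = 0 ∧ min (u - y) 0 = 0) := by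
  rcases lt_or_ge (y + L) u with h | h
  · exact Or.inl ⟨h, max_eq_left (by linarith), min_eq_right (by linarith)⟩
  · rcases lt_or_ge u y with h' | h'
    · exact Or.inr (Or.inl ⟨h', max_eq_right (by linarith), min_eq_left (by linarith)⟩)
    · exact Or.inr (Or.inr ⟨h', h, max_eq_right (by linarith), min_eq_right (by linarith)⟩)

theorem sub_excess_mem {L : ℝ} (hL : 0 ≤ L) (y u : ℝ) :
    y ≤ u - excess L y u ∧ u - excess L y u ≤ y + L := by
  unfold excess
  rcases excess_cases hL y u with ⟨h, h1, h2⟩ | ⟨h, h1, h2⟩ | ⟨h, h', h1, h2⟩ <;>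
    rw [h1, h2] <;> constructor <;> linarith

/-- The excess is nonzero only when the projection is an endpoint of the window, so the exponential
is `exp (y + L)` or `exp y` there. This is where the weight in `balance` comes from. -/
theorem exp_sub_excess_mul_excess {L : ℝ} (hL : 0 ≤ L) (y u : ℝ) :
    Real.exp (u - excess L y u) * excess L y u =
      Real.exp y * (Real.exp L * max (u - L - y) 0 + min (u - y) 0) := by
  unfold excess
  rcases excess_cases hL y u with ⟨_, h1, h2⟩ | ⟨_, h1, h2⟩ | ⟨_, _, h1, h2⟩ <;> rw [h1, h2]
  · rw [show u - (u - L - y + 0) = y + L by ring, Real.exp_add]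
    ring
  · rw [show u - (0 + (u - y)) = y by ring]
    ring
  · ring

/-- The first-order condition on the cone of feasible attractivenesses. -/
theorem sum_mul_excess_nonpos {k : ℕ} {u x : Fin k → ℝ} (hu : Antitone u) {τ L y : ℝ}
    (hτ : 0 < τ) (hL : 0 ≤ L) (hxx : ∀ i j, i < j → x i ≤ τ * x j)
    (hy : ∑ i, (τ * max (u i - L - y) 0 + min (u i - y) 0) = 0) :
    ∑ i, x i * excess L y (u i) ≤ 0 := by
  set α : Fin k → ℝ := fun i => max (u i - L - y) 0 with hα
  set β : Fin k → ℝ := fun i => - min (u i - y) 0 with hβ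
  have hα0 : ∀ i, 0 ≤ α i := fun i => le_max_right _ _
  have hβ0 : ∀ i, 0 ≤ β i := fun i => neg_nonneg.2 (min_le_right _ _)
  have hsum : τ * ∑ i, α i = ∑ i, β i := by
    rw [Finset.sum_add_distrib, ← Finset.mul_sum] at hy
    simp only [hβ, Finset.sum_neg_distrib]
    linarith
  have hsplit : ∑ i, x i * excess L y (u i) = ∑ i, x i * α i - ∑ i, x i * β i := by
    rw [← Finset.sum_sub_distrib]
    refine Finset.sum_congr rfl fun i _ => ?_
    simp only [excess, hα, hβ]
    ring
  -- A nonzero term has `u i` above the window and `u j` below it. Since `u` is antitone, `i < j`,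
  -- so the constraint for this pair is available.
  have hpair : ∀ i j, x i * α i * β j ≤ τ * α i * (x j * β j) := by
    intro i j
    rcases (hα0 i).eq_or_lt with h | h
    · simp [← h]
    rcases (hβ0 j).eq_or_lt with h' | h'
    · simp [← h']
    have h1 : y + L < u i := by
      by_contra hc
      have : α i = 0 := max_eq_right (by linarith)
      linarith
    have h2 : u j < y := by
      by_contra hc
      have : min (u j - y) 0 = 0 := min_eq_right (by linarith)
      simp only [hβ, this] at h'
      linarith
    have hij : i < j := by
      by_contra hc
      have := hu (not_lt.1 hc)
      linarith
    have := mul_le_mul_of_nonneg_right (hxx i j hij) (mul_pos h h').le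
    nlinarith
  -- Sum over all pairs and replace `τ * ∑ α` by `∑ β`; the common factor `∑ β` is cancelled below
  -- unless it vanishes, in which case every `α` and `β` is zero.
  have hprod : (∑ i, x i * α i) * ∑ j, β j ≤ (∑ j, β j) * ∑ j, x j * β j := by
    nth_rewrite 2 [← hsum]
    rw [Finset.mul_sum Finset.univ α, Finset.sum_mul_sum, Finset.sum_mul_sum]
    exact Finset.sum_le_sum fun i _ => Finset.sum_le_sum fun j _ => hpair i j
  rw [hsplit]
  rcases (Finset.sum_nonneg fun j (_ : j ∈ Finset.univ) => hβ0 j).eq_or_lt with h | h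
  · have hβz : ∀ j, β j = 0 := fun j =>
      (Finset.sum_eq_zero_iff_of_nonneg fun j _ => hβ0 j).1 h.symm j (Finset.mem_univ j)
    have h0 : ∑ i, α i = 0 := by
      have h1 : τ * ∑ i, α i = 0 := by rw [hsum, ← h]
      exact (mul_eq_zero.1 h1).resolve_left hτ.ne'
    have hαz : ∀ i, α i = 0 := fun i =>
      (Finset.sum_eq_zero_iff_of_nonneg fun j _ => hα0 j).1 h0 i (Finset.mem_univ i)
    simp [hβz, hαz]
  · have : ∑ i, x i * α i ≤ ∑ j, x j * β j := by
      rw [mul_comm] at hprod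
      exact le_of_mul_le_mul_left hprod h
    linarith

/-- Any zero `y` of the balance serves, so uniqueness of the zero is never needed. -/
theorem isOptimalPricing_of_balanced {k : ℕ} {u : Fin k → ℝ} (hu : Antitone u) {a₀ t L y l : ℝ}
    (ha : 0 < a₀) (ht : 0 < t) (hL : L = Real.log (1 + t))
    (hy : ∑ i, ((1 + t) * max (u i - L - y) 0 + min (u i - y) 0) = 0)
    (hl : l = lambertW ((∑ i, Real.exp (u i - excess L y (u i))) / (Real.exp 1 * a₀)))
    {p : Fin k → ℝ} (hp : ∀ i, p i = excess L y (u i) + l + 1) :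
    IsOptimalPricing u a₀ t p ∧ l = revenue u a₀ p := by
  have hL0 : 0 ≤ L := hL ▸ Real.log_nonneg (by linarith)
  have hexpL : Real.exp L = 1 + t := by rw [hL, Real.exp_log (by linarith)]
  have hz : ∀ i, Real.exp (u i - p i) =
      Real.exp (-l - 1) * Real.exp (u i - excess L y (u i)) := by
    intro i
    rw [← Real.exp_add, hp]
    ring_nf
  -- The defining equation of the Lambert function, multiplied by `exp (-l - 1)`.
  have hsumz : ∑ i, Real.exp (u i - p i) = l * a₀ := by
    have hV : 0 ≤ (∑ i, Real.exp (u i - excess L y (u i))) / (Real.exp 1 * a₀) := by positivity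
    have h := (lambertW_spec hV).2
    rw [← hl, eq_div_iff (by positivity)] at h
    simp only [hz]
    rw [← Finset.mul_sum, ← h, sub_eq_add_neg, Real.exp_add, Real.exp_neg, Real.exp_neg]
    field_simp
  have hzex : ∑ i, Real.exp (u i - p i) * excess L y (u i) = 0 := by
    have : ∀ i, Real.exp (u i - p i) * excess L y (u i) = Real.exp (-l - 1) * Real.exp y *
        ((1 + t) * max (u i - L - y) 0 + min (u i - y) 0) := by
      intro i
      rw [hz, mul_assoc, exp_sub_excess_mul_excess hL0, hexpL]
      ring
    simp only [this]
    rw [← Finset.mul_sum, hy, mul_zero]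
  have hpos : ∀ q : Fin k → ℝ, 0 < ∑ i, Real.exp (u i - q i) + a₀ := fun q => by positivity
  have hrev : revenue u a₀ p = l := by
    rw [revenue, div_eq_iff (by exact (hpos p).ne')]
    simp only [attractiveness]
    have : ∑ i, p i * Real.exp (u i - p i) = ∑ i, Real.exp (u i - p i) * excess L y (u i) +
        (l + 1) * ∑ i, Real.exp (u i - p i) := by
      rw [Finset.mul_sum, ← Finset.sum_add_distrib]
      refine Finset.sum_congr rfl fun i _ => ?_
      rw [show p i * Real.exp (u i - p i) =
        (excess L y (u i) + l + 1) * Real.exp (u i - p i) by rw [← hp]]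
      ring
    rw [this, hzex, hsumz]
    ring
  refine ⟨⟨fun i j _ => ?_, fun q hq => ?_⟩, hrev.symm⟩
  · simp only [attractiveness]
    rw [hz, hz, sub_nonpos, ← hexpL]
    simp only [← Real.exp_add]
    have h1 := (sub_excess_mem hL0 y (u i)).2
    have h2 := (sub_excess_mem hL0 y (u j)).1
    exact Real.exp_le_exp.2 (by linarith)
  · rw [hrev, revenue, div_le_iff₀ (by exact hpos q)]
    simp only [attractiveness]
    have hcone := sum_mul_excess_nonpos (x := fun i => Real.exp (u i - q i)) hu
      (by linarith : 0 < 1 + t) hL0 (fun i j hij => sub_nonpos.1 (hq i j hij)) hy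
    -- The tangent-line bound `q i - p i + 1 ≤ exp (q i - p i)`, multiplied by `exp (u i - q i)`.
    have htan : ∀ i, q i * Real.exp (u i - q i) ≤ Real.exp (u i - q i) * excess L y (u i) +
        l * Real.exp (u i - q i) + Real.exp (u i - p i) := by
      intro i
      have h1 := mul_le_mul_of_nonneg_left (Real.add_one_le_exp (q i - p i))
        (Real.exp_pos (u i - q i)).le
      rw [← Real.exp_add, show u i - q i + (q i - p i) = u i - p i by ring] at h1
      have h2 : Real.exp (u i - q i) * p i =
        Real.exp (u i - q i) * (excess L y (u i) + l + 1) := by rw [← hp]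
      linarith
    have := Finset.sum_le_sum fun i (_ : i ∈ Finset.univ) => htan i
    rw [Finset.sum_add_distrib, Finset.sum_add_distrib, ← Finset.mul_sum, hsumz] at this
    linarith

/-! ### The zero of `balance` -/

theorem balance_antitone {τ : ℝ} (hτ : 0 ≤ τ) (L : ℝ) (u : ℕ → ℝ) (k : ℕ) :
    Antitone (balance τ L u k) := by
  intro a b hab
  refine Finset.sum_le_sum fun i _ => add_le_add (mul_le_mul_of_nonneg_left ?_ hτ) ?_
  · exact max_le_max (by linarith) le_rfl
  · exact min_le_min (by linarith) le_rfl

theorem balance_continuous (τ L : ℝ) (u : ℕ → ℝ) (k : ℕ) : Continuous (balance τ L u k) := by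
  unfold balance
  fun_prop

theorem balance_nonneg {τ L : ℝ} (hτ : 0 ≤ τ) {u : ℕ → ℝ} {k : ℕ} {y : ℝ}
    (h : ∀ i < k, y ≤ u i) : 0 ≤ balance τ L u k y := by
  refine Finset.sum_nonneg fun i hi => add_nonneg (mul_nonneg hτ (le_max_right _ _)) ?_
  exact le_min (by linarith [h i (Finset.mem_range.1 hi)]) le_rfl

theorem balance_nonpos {τ L : ℝ} {u : ℕ → ℝ} {k : ℕ} {y : ℝ}
    (h : ∀ i < k, u i - L ≤ y) : balance τ L u k y ≤ 0 := by
  refine Finset.sum_nonpos fun i hi => ?_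
  rw [max_eq_right (by linarith [h i (Finset.mem_range.1 hi)]), mul_zero, zero_add]
  exact min_le_right _ _

/-- One Newton step from the largest breakpoint with nonnegative balance hits the zero. -/
theorem balance_newton {τ L : ℝ} (hτ : 0 < τ) (hL : 0 ≤ L) {u : ℕ → ℝ} {k : ℕ} {v : ℝ}
    (hv : 0 ≤ balance τ L u k v) (hmin : ∃ i < k, u i ≤ v)
    (h₁ : ∀ i < k, 0 ≤ balance τ L u k (u i) → u i ≤ v)
    (h₂ : ∀ i < k, 0 ≤ balance τ L u k (u i - L) → u i - L ≤ v) :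
    balance τ L u k (v + balance τ L u k v / balanceSlope τ L u k v) = 0 := by
  obtain ⟨y, hvy, hy⟩ : ∃ y, v ≤ y ∧ balance τ L u k y = 0 := by
    -- `M` lies above every `u i`, so the balance is nonpositive there and changes sign on `[v, M]`.
    set M := v + ∑ i ∈ Finset.range k, |u i - v| with hM
    have hvM : v ≤ M := le_add_of_nonneg_right (Finset.sum_nonneg fun _ _ => abs_nonneg _)
    have hMneg : balance τ L u k M ≤ 0 := by
      refine balance_nonpos fun i hi => ?_
      have : |u i - v| ≤ ∑ i ∈ Finset.range k, |u i - v| := Finset.single_le_sum (f := fun i => |u i - v|) (fun _ _ => abs_nonneg _)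
        (Finset.mem_range.2 hi)
      have := le_abs_self (u i - v)
      linarith
    obtain ⟨y, hy, h⟩ := intermediate_value_Icc' hvM (balance_continuous τ L u k).continuousOn
      ⟨hMneg, hv⟩
    exact ⟨y, hy.1, h⟩
  have hanti := balance_antitone hτ.le L u k
  -- No breakpoint lies in `(v, y]`: by monotonicity its balance would be nonnegative, contradicting
  -- the choice of `v`. Hence the balance is affine on `[v, y]`, with the right derivative at `v` as
  -- its slope.
  have hgap : ∀ w, (0 ≤ balance τ L u k w → w ≤ v) → w ≤ v ∨ y < w := by
    intro w hw
    by_contra! hc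
    exact absurd (hw (hy ▸ hanti hc.2)) (not_le.2 hc.1)
  have hlin : balance τ L u k y = balance τ L u k v - balanceSlope τ L u k v * (y - v) := by
    unfold balance balanceSlope
    rw [Finset.sum_mul, ← Finset.sum_sub_distrib]
    refine Finset.sum_congr rfl fun i hi => ?_
    have hi := Finset.mem_range.1 hi
    have e1 : min (u i - y) 0 = min (u i - v) 0 - (if u i ≤ v then 1 else 0) * (y - v) := by
      rcases hgap _ (h₁ i hi) with h | h
      · rw [if_pos h, min_eq_left (by linarith), min_eq_left (by linarith)]
        ring
      · rw [if_neg (by linarith), min_eq_right (by linarith), min_eq_right (by linarith)]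
        ring
    have e2 : τ * max (u i - L - y) 0 =
        τ * max (u i - L - v) 0 - (if u i - L ≤ v then 0 else τ) * (y - v) := by
      rcases hgap _ (h₂ i hi) with h | h
      · rw [if_pos h, max_eq_right (by linarith), max_eq_right (by linarith)]
        ring
      · rw [if_neg (by linarith), max_eq_left (by linarith), max_eq_left (by linarith)]
        ring
    rw [e1, e2]
    ring
  have hpos : 0 < balanceSlope τ L u k v := by
    obtain ⟨i, hi, hiv⟩ := hmin
    refine Finset.sum_pos' (fun j _ => ?_) ⟨i, Finset.mem_range.2 hi, ?_⟩
    · split_ifs <;> linarith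
    · rw [if_pos hiv]
      split_ifs <;> linarith
  have : v + balance τ L u k v / balanceSlope τ L u k v = y := by
    rw [hy] at hlin
    field_simp
    linarith
  rw [this, hy]

/-! ### Reasoning about programs -/

/-- Started on `m`, the program `c` halts within `B` steps on a memory satisfying `Q`. -/
def Terminates (c : Program) (m : Memory) (B : ℕ) (Q : Memory → Prop) : Prop :=
  ∃ m' T, Run c m m' T ∧ T ≤ B ∧ Q m'

namespace Terminates

variable {c c₁ c₂ : Program} {m : Memory} {B B' B₁ B₂ : ℕ} {Q Q' : Memory → Prop}

theorem mono (h : Terminates c m B Q) (hB : B ≤ B') (hQ : ∀ m', Q m' → Q' m') :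
    Terminates c m B' Q' := by
  obtain ⟨m', T, hr, hT, hq⟩ := h
  exact ⟨m', T, hr, hT.trans hB, hQ _ hq⟩

theorem seq (h₁ : Terminates c₁ m B₁ Q') (h₂ : ∀ m', Q' m' → Terminates c₂ m' B₂ Q) :
    Terminates (.seq c₁ c₂) m (B₁ + B₂) Q := by
  obtain ⟨m₁, T₁, hr₁, hT₁, hq₁⟩ := h₁
  obtain ⟨m₂, T₂, hr₂, hT₂, hq₂⟩ := h₂ m₁ hq₁
  exact ⟨m₂, T₁ + T₂, .seq hr₁ hr₂, add_le_add hT₁ hT₂, hq₂⟩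

end Terminates

/-- The weakest precondition of a loop-free program. -/
def Program.Straight : Program → Memory → (Memory → Prop) → Prop
  | .skip, m, Q => Q m
  | .setIdx x e, m, Q => Q (m.setIdx x (e.eval m))
  | .setCell a e r, m, Q => Q (m.setCell a (e.eval m) (r.eval m))
  | .seq c₁ c₂, m, Q => c₁.Straight m fun m' => c₂.Straight m' Q
  | .ite b c₁ c₂, m, Q => (b.Holds m → c₁.Straight m Q) ∧ (¬ b.Holds m → c₂.Straight m Q)
  | .loop _ _, _, _ => False

/-- An upper bound for the number of steps of a loop-free program. -/
def Program.cost : Program → ℕ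
  | .skip => 1
  | .setIdx _ e => e.cost + 1
  | .setCell _ e r => e.cost + r.cost + 1
  | .seq c₁ c₂ => c₁.cost + c₂.cost
  | .ite b c₁ c₂ => b.cost + 1 + (c₁.cost + c₂.cost)
  | .loop _ _ => 0

theorem Program.Straight.terminates {c : Program} {m : Memory} {Q : Memory → Prop}
    (h : c.Straight m Q) : Terminates c m c.cost Q := by
  induction c generalizing m Q with
  | skip => exact ⟨m, 1, .skip m, le_rfl, h⟩
  | setIdx x e => exact ⟨_, _, .setIdx m x e, le_rfl, h⟩
  | setCell a e r => exact ⟨_, _, .setCell m a e r, le_rfl, h⟩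
  | seq c₁ c₂ ih₁ ih₂ => exact (ih₁ h).seq fun m' h' => ih₂ h'
  | ite b c₁ c₂ ih₁ ih₂ =>
    by_cases hb : b.Holds m
    · obtain ⟨m', T, hr, hT, hq⟩ := ih₁ (h.1 hb)
      exact ⟨m', _, .iteTrue hb hr, by simp only [Program.cost]; omega, hq⟩
    · obtain ⟨m', T, hr, hT, hq⟩ := ih₂ (h.2 hb)
      exact ⟨m', _, .iteFalse hb hr, by simp only [Program.cost]; omega, hq⟩
  | loop b c _ => exact h.elim

/-- "For `x` from its present value up to (register `0`) `- 1` do `c`". -/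
def forLoop (x : ℕ) (c : Program) : Program :=
  .loop (.idxLe (.add (.reg x) (.const 1)) (.reg 0)) (.seq c (.setIdx x (.add (.reg x) (.const 1))))

/-- Each pass costs the body plus 6 steps for the test and 4 for the increment; the final failing
test costs 6. The body is allowed to end in any memory for which the invariant holds after the
increment. -/
theorem Terminates.forLoop {x k B : ℕ} {c : Program} (I : ℕ → Memory → Prop)
    (hI : ∀ j m, I j m → m.idx 0 = k ∧ m.idx x = j)
    (hc : ∀ j < k, ∀ m, I j m →
      Terminates c m B fun m' => I (j + 1) (m'.setIdx x (m'.idx x + 1)))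
    {m : Memory} (h : I 0 m) :
    Terminates (forLoop x c) m (k * (B + 10) + 6) (I k) := by
  -- Induction on the number `d` of remaining passes.
  suffices H : ∀ d j m, j + d = k → I j m →
      Terminates (ThresholdLuce.forLoop x c) m (d * (B + 10) + 6) (I k) from H k 0 m (zero_add k) h
  intro d
  induction d with
  | zero =>
    intro j m hj h
    obtain rfl : j = k := by simpa using hj
    obtain ⟨h0, hx⟩ := hI _ _ h
    refine ⟨m, _, .loopDone ?_, ?_, h⟩
    · simp [Test.Holds, IdxExpr.eval, h0, hx]
    · simp [Test.cost, IdxExpr.cost]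
  | succ d ih =>
    intro j m hj h
    obtain ⟨h0, hx⟩ := hI _ _ h
    obtain ⟨m₁, T₁, hr₁, hT₁, hq₁⟩ := hc j (by omega) m h
    obtain ⟨m₂, T₂, hr₂, hT₂, hq₂⟩ := ih (j + 1) _ (by omega) hq₁
    refine ⟨m₂, _, .loopStep ?_ (.seq hr₁ (.setIdx _ _ _)) hr₂, ?_, hq₂⟩
    · simp only [Test.Holds, IdxExpr.eval, h0, hx]
      omega
    · simp only [Test.cost, IdxExpr.cost]
      rw [add_mul]
      omega

/-! ### The program

Register `2` is the counter of the outer loop, register `3` that of the inner loops. The arrays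
`4` to `10` hold in their cell `0` the logarithm of `1 + t`, the best breakpoint so far, the
breakpoint under consideration, the balance there, its slope, the zero of the balance, and the sum
of the unscaled attractivenesses. -/

/-- The number in cell `0` of the array `a`. -/
def scalar (a : ℕ) : RealExpr := .cell a (.const 0)

/-- `x := r`, for the number `x` in cell `0` of the array `a`. -/
def setScalar (a : ℕ) (r : RealExpr) : Program := .setCell a (.const 0) r

/-- The utility of the product whose number is in the register `x`. -/
def utility (x : ℕ) : RealExpr := .cell 0 (.reg x)

/-- The number `1 + t`. -/
def factor : RealExpr := .add (.ofIdx (.const 1)) (.cell 1 (.const 1))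

def balanceStep : Program :=
  .seq
    (.ite (.realLe (utility 3) (scalar 6))
      (.seq (setScalar 7 (.add (scalar 7) (.sub (utility 3) (scalar 6))))
        (setScalar 8 (.add (scalar 8) (.ofIdx (.const 1))))) .skip)
    (.ite (.realLe (.sub (utility 3) (scalar 4)) (scalar 6)) .skip
      (.seq
        (setScalar 7 (.add (scalar 7)
          (.mul factor (.sub (.sub (utility 3) (scalar 4)) (scalar 6)))))
        (setScalar 8 (.add (scalar 8) factor))))

def balanceInit : Program :=
  .seq (.setIdx 3 (.const 0))
    (.seq (setScalar 7 (.ofIdx (.const 0))) (setScalar 8 (.ofIdx (.const 0))))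

def computeBalance : Program := .seq balanceInit (forLoop 3 balanceStep)

def updateBest : Program :=
  .ite (.conj (.realLe (.ofIdx (.const 0)) (scalar 7)) (.realLe (scalar 5) (scalar 6)))
    (setScalar 5 (scalar 6)) .skip

def considerBreakpoint (r : RealExpr) : Program :=
  .seq (setScalar 6 r) (.seq computeBalance updateBest)

/-- The search starts from the last, hence smallest, of the `k` utilities, where the balance is
nonnegative. -/
def searchInit : Program :=
  .seq (setScalar 4 (.ln factor)) (setScalar 5 (.cell 0 (.sub (.reg 0) (.const 1))))

def search : Program :=
  .seq searchInit
    (forLoop 2 (.seq (considerBreakpoint (utility 2))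
      (considerBreakpoint (.sub (utility 2) (scalar 4)))))

def newtonStep : Program :=
  .seq (setScalar 6 (scalar 5))
    (.seq computeBalance
      (.seq (setScalar 9 (.add (scalar 6) (.div (scalar 7) (scalar 8))))
        (.seq (.setIdx 3 (.const 0)) (setScalar 10 (.ofIdx (.const 0))))))

def excessStep : Program :=
  .seq (.setCell 2 (.reg 3) (.ofIdx (.const 0)))
    (.seq
      (.ite (.realLe (utility 3) (scalar 9))
        (.setCell 2 (.reg 3) (.sub (utility 3) (scalar 9))) .skip)
      (.seq
        (.ite (.realLe (.sub (utility 3) (scalar 4)) (scalar 9)) .skip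
          (.setCell 2 (.reg 3) (.sub (.sub (utility 3) (scalar 4)) (scalar 9))))
        (setScalar 10 (.add (scalar 10) (.exp (.sub (utility 3) (.cell 2 (.reg 3))))))))

def revenueStep : Program :=
  .seq (setScalar 3 (.lambert (.div (scalar 10) (.mul (.exp (.ofIdx (.const 1))) (scalar 1)))))
    (.setIdx 3 (.const 0))

def priceStep : Program :=
  .setCell 2 (.reg 3) (.add (.add (.cell 2 (.reg 3)) (scalar 3)) (.ofIdx (.const 1)))

/-- The program that solves the pricing problem. -/
def solve : Program :=
  .seq search
    (.seq newtonStep (.seq (forLoop 3 excessStep) (.seq revenueStep (forLoop 3 priceStep))))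

/-- The data that stay fixed while the program runs. -/
structure Env (k : ℕ) (u : ℕ → ℝ) (a₀ t L : ℝ) (m : Memory) : Prop where
  idx_zero : m.idx 0 = k
  utilities : m.arr 0 = u
  outside : m.arr 1 0 = a₀
  threshold : m.arr 1 1 = t
  logFactor : m.arr 4 0 = L

/-! ### Correctness and running time of the program -/

theorem computeBalance_terminates {m₀ : Memory} {k : ℕ} {u : ℕ → ℝ} {a₀ t L v b : ℝ} {j : ℕ}
    (hL : 0 ≤ L) (h : Env k u a₀ t L m₀) (hv : m₀.arr 6 0 = v) (hb : m₀.arr 5 0 = b)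
    (hj : m₀.idx 2 = j) :
    Terminates computeBalance m₀ (balanceInit.cost + (k * (balanceStep.cost + 10) + 6)) fun m =>
      Env k u a₀ t L m ∧ m.idx 2 = j ∧ m.arr 5 0 = b ∧ m.arr 6 0 = v ∧
      m.arr 7 0 = balance (1 + t) L u k v ∧ m.arr 8 0 = balanceSlope (1 + t) L u k v := by
  -- The partial sums are again balances and slopes, for the first `i` products.
  let I : ℕ → Memory → Prop := fun i m =>
    (Env k u a₀ t L m ∧ m.idx 2 = j ∧ m.arr 5 0 = b ∧ m.arr 6 0 = v ∧
      m.arr 7 0 = balance (1 + t) L u i v ∧ m.arr 8 0 = balanceSlope (1 + t) L u i v) ∧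
    m.idx 3 = i
  refine (Program.Straight.terminates (Q := I 0) ?_).seq fun m hm =>
    (Terminates.forLoop I (fun i m h => ⟨h.1.1.idx_zero, h.2⟩) (fun i hi m hm => ?_) hm).mono
      le_rfl fun m h => h.1
  · obtain ⟨h0, h1, h2, h3, h4⟩ := h
    simp [balanceInit, Program.Straight, setScalar, IdxExpr.eval, RealExpr.eval, Memory.setIdx,
      Memory.setCell, I, balance, balanceSlope, *]
    exact ⟨by simpa, by simpa, by simpa, by simpa, by simpa⟩
  · obtain ⟨⟨⟨h0, h1, h2, h3, h4⟩, h5, h6, h7, h8, h9⟩, h10⟩ := hm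
    refine Program.Straight.terminates ?_
    have e1 : balance (1 + t) L u (i + 1) v = balance (1 + t) L u i v +
        ((1 + t) * max (u i - L - v) 0 + min (u i - v) 0) := Finset.sum_range_succ _ _
    have e2 : balanceSlope (1 + t) L u (i + 1) v = balanceSlope (1 + t) L u i v +
        ((if u i ≤ v then 1 else 0) + if u i - L ≤ v then 0 else 1 + t) :=
      Finset.sum_range_succ _ _
    by_cases c1 : u i ≤ v
    · have c2 : u i - L ≤ v := by linarith
      have m1 : max (u i - L - v) 0 = 0 := max_eq_right (by linarith)
      have m2 : min (u i - v) 0 = u i - v := min_eq_left (by linarith)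
      simp [balanceStep, Program.Straight, setScalar, scalar, utility, Test.Holds, IdxExpr.eval,
        RealExpr.eval, Memory.setIdx, Memory.setCell, I, *]
      exact ⟨by simpa, by simpa, by simpa, by simpa, by simpa⟩
    · have m2 : min (u i - v) 0 = 0 := min_eq_right (by linarith)
      by_cases c2 : u i - L ≤ v
      · have m1 : max (u i - L - v) 0 = 0 := max_eq_right (by linarith)
        simp [balanceStep, Program.Straight, setScalar, scalar, utility, Test.Holds, IdxExpr.eval,
          RealExpr.eval, Memory.setIdx, Memory.setCell, I, *]
        exact ⟨by simpa, by simpa, by simpa, by simpa, by simpa⟩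
      · have m1 : max (u i - L - v) 0 = u i - L - v := max_eq_left (by linarith)
        simp [balanceStep, Program.Straight, setScalar, scalar, utility, factor, Test.Holds,
          IdxExpr.eval, RealExpr.eval, Memory.setIdx, Memory.setCell, I, *]
        exact ⟨by simpa, by simpa, by simpa, by simpa, by simpa⟩

/-- The postcondition is what a running maximum over the breakpoints of nonnegative balance needs:
the best value never decreases, is either kept or has nonnegative balance, and bounds `w` whenever
`w` qualifies. -/
theorem considerBreakpoint_terminates {m₀ : Memory} {k : ℕ} {u : ℕ → ℝ} {a₀ t L w b : ℝ} {j : ℕ}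
    {r : RealExpr} (hL : 0 ≤ L) (h : Env k u a₀ t L m₀) (hr : r.eval m₀ = w)
    (hb : m₀.arr 5 0 = b) (hj : m₀.idx 2 = j) :
    Terminates (considerBreakpoint r) m₀ ((setScalar 6 r).cost +
        (balanceInit.cost + (k * (balanceStep.cost + 10) + 6) + updateBest.cost)) fun m =>
      Env k u a₀ t L m ∧ m.idx 2 = j ∧ b ≤ m.arr 5 0 ∧
      (m.arr 5 0 = b ∨ 0 ≤ balance (1 + t) L u k (m.arr 5 0)) ∧
      (0 ≤ balance (1 + t) L u k w → w ≤ m.arr 5 0) := by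
  refine (Program.Straight.terminates (Q := fun m => Env k u a₀ t L m ∧ m.idx 2 = j ∧
    m.arr 5 0 = b ∧ m.arr 6 0 = w) ?_).seq fun m hm =>
    (computeBalance_terminates hL hm.1 hm.2.2.2 hm.2.2.1 hm.2.1).seq fun m' hm' =>
      Program.Straight.terminates ?_
  · obtain ⟨h0, h1, h2, h3, h4⟩ := h
    simp [Program.Straight, setScalar, IdxExpr.eval, Memory.setCell, *]
    exact ⟨by simpa, by simpa, by simpa, by simpa, by simpa⟩
  · obtain ⟨⟨h0, h1, h2, h3, h4⟩, h5, h6, h7, h8, -⟩ := hm'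
    refine ⟨fun hc => ?_, fun hc => ?_⟩
    · simp [Test.Holds, scalar, RealExpr.eval, IdxExpr.eval, h6, h7, h8] at hc
      simp [Program.Straight, setScalar, scalar, IdxExpr.eval, RealExpr.eval, Memory.setCell, *]
      exact ⟨by simpa, by simpa, by simpa, by simpa, by simpa⟩
    · simp [Test.Holds, scalar, RealExpr.eval, IdxExpr.eval, h6, h7, h8] at hc
      simp only [Program.Straight]
      exact ⟨⟨h0, h1, h2, h3, h4⟩, h5, h6.ge, Or.inl h6, fun h => h6 ▸ (hc h).le⟩

/-- A bound for the number of steps of `considerBreakpoint r`. -/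
def considerCost (r : RealExpr) (k : ℕ) : ℕ :=
  (setScalar 6 r).cost + (balanceInit.cost + (k * (balanceStep.cost + 10) + 6) + updateBest.cost)

theorem search_terminates {m₀ : Memory} {k : ℕ} {u : ℕ → ℝ} {a₀ t : ℝ} (ht : 0 < t) (hk : 0 < k)
    (h0 : m₀.idx 0 = k) (h2 : m₀.idx 2 = 0) (hu : m₀.arr 0 = u) (hmin : ∀ i < k, u (k - 1) ≤ u i)
    (h10 : m₀.arr 1 0 = a₀) (h11 : m₀.arr 1 1 = t) :
    Terminates search m₀ (searchInit.cost + (k * (considerCost (utility 2) k +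
      considerCost (.sub (utility 2) (scalar 4)) k + 10) + 6)) fun m =>
      Env k u a₀ t (Real.log (1 + t)) m ∧ balance (1 + t) (Real.log (1 + t)) u k (m.arr 5 0 +
        balance (1 + t) (Real.log (1 + t)) u k (m.arr 5 0) /
          balanceSlope (1 + t) (Real.log (1 + t)) u k (m.arr 5 0)) = 0 := by
  set L := Real.log (1 + t) with hL
  have hL0 : 0 ≤ L := Real.log_nonneg (by linarith)
  -- The lower bound `u (k - 1)` keeps at least one utility at or below the best value, which makes
  -- the slope in the Newton step positive.
  let I : ℕ → Memory → Prop := fun j m => Env k u a₀ t L m ∧ m.idx 2 = j ∧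
    u (k - 1) ≤ m.arr 5 0 ∧ 0 ≤ balance (1 + t) L u k (m.arr 5 0) ∧
    (∀ i < j, 0 ≤ balance (1 + t) L u k (u i) → u i ≤ m.arr 5 0) ∧
    ∀ i < j, 0 ≤ balance (1 + t) L u k (u i - L) → u i - L ≤ m.arr 5 0
  refine (Program.Straight.terminates (Q := I 0) ?_).seq fun m hm =>
    (Terminates.forLoop I (fun i m h => ⟨h.1.idx_zero, h.2.1⟩) (fun j hj m hm => ?_) hm).mono
      le_rfl fun m h => ⟨h.1, ?_⟩
  · have := balance_nonneg (τ := 1 + t) (L := L) (by linarith) hmin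
    simp [searchInit, Program.Straight, setScalar, factor, IdxExpr.eval, RealExpr.eval,
      Memory.setCell, I, *]
    refine ⟨⟨by simpa, by simpa, by simpa, by simpa, by simp⟩, ?_⟩
    rwa [← hL]
  · obtain ⟨he, h2, h3, h4, h5, h6⟩ := hm
    have hw : (utility 2).eval m = u j := by
      simp [utility, RealExpr.eval, IdxExpr.eval, h2, he.utilities]
    refine (considerBreakpoint_terminates hL0 he hw rfl h2).seq fun m₁ hm₁ => ?_
    obtain ⟨he₁, h2₁, hb₁, hc₁, hd₁⟩ := hm₁
    have hw₁ : (RealExpr.sub (utility 2) (scalar 4)).eval m₁ = u j - L := by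
      simp [utility, scalar, RealExpr.eval, IdxExpr.eval, h2₁, he₁.utilities, he₁.logFactor]
    refine (considerBreakpoint_terminates hL0 he₁ hw₁ rfl h2₁).mono le_rfl fun m₂ hm₂ => ?_
    obtain ⟨⟨e0, e1, e2, e3, e4⟩, h2₂, hb₂, hc₂, hd₂⟩ := hm₂
    have hb := hb₁.trans hb₂
    refine ⟨⟨by simpa [Memory.setIdx], e1, e2, e3, e4⟩, by simp [Memory.setIdx, h2₂],
      h3.trans hb, ?_, fun i hi hn => ?_, fun i hi hn => ?_⟩
    · rcases hc₂ with hc₂ | hc₂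
      · rcases hc₁ with hc₁ | hc₁
        · simpa [Memory.setIdx, hc₂, hc₁] using h4
        · simpa [Memory.setIdx, hc₂] using hc₁
      · exact hc₂
    · rcases (Nat.lt_succ_iff_lt_or_eq.1 hi) with hi | rfl
      · exact (h5 i hi hn).trans hb
      · exact (hd₁ hn).trans hb₂
    · rcases (Nat.lt_succ_iff_lt_or_eq.1 hi) with hi | rfl
      · exact (h6 i hi hn).trans hb
      · exact hd₂ hn
  · exact balance_newton (by linarith) hL0 h.2.2.2.1 ⟨k - 1, by omega, h.2.2.1⟩ h.2.2.2.2.1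
      h.2.2.2.2.2

theorem newtonStep_terminates {m₀ : Memory} {k : ℕ} {u : ℕ → ℝ} {a₀ t L v : ℝ} (hL : 0 ≤ L)
    (h : Env k u a₀ t L m₀) (hv : m₀.arr 5 0 = v) :
    Terminates newtonStep m₀ ((setScalar 6 (scalar 5)).cost +
      (balanceInit.cost + (k * (balanceStep.cost + 10) + 6) +
        Program.cost (.seq (setScalar 9 (.add (scalar 6) (.div (scalar 7) (scalar 8))))
        (.seq (.setIdx 3 (.const 0)) (setScalar 10 (.ofIdx (.const 0))))))) fun m =>
      Env k u a₀ t L m ∧ m.idx 3 = 0 ∧ m.arr 10 0 = 0 ∧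
      m.arr 9 0 = v + balance (1 + t) L u k v / balanceSlope (1 + t) L u k v := by
  refine (Program.Straight.terminates (Q := fun m => Env k u a₀ t L m ∧ m.idx 2 = m₀.idx 2 ∧
    m.arr 5 0 = v ∧ m.arr 6 0 = v) ?_).seq fun m hm =>
    (computeBalance_terminates hL hm.1 hm.2.2.2 hm.2.2.1 hm.2.1).seq fun m' hm' =>
      Program.Straight.terminates ?_
  · obtain ⟨h0, h1, h2, h3, h4⟩ := h
    simp [Program.Straight, setScalar, scalar, IdxExpr.eval, RealExpr.eval, Memory.setCell, *]
    exact ⟨by simpa, by simpa, by simpa, by simpa, by simpa⟩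
  · obtain ⟨⟨h0, h1, h2, h3, h4⟩, h5, h6, h7, h8, h9⟩ := hm'
    simp [Program.Straight, setScalar, scalar, IdxExpr.eval, RealExpr.eval, Memory.setIdx,
      Memory.setCell, *]
    exact ⟨by simpa, by simpa, by simpa, by simpa, by simpa⟩

theorem excess_terminates {m₀ : Memory} {k : ℕ} {u : ℕ → ℝ} {a₀ t L y : ℝ} (hL : 0 ≤ L)
    (h : Env k u a₀ t L m₀) (h3 : m₀.idx 3 = 0) (h10 : m₀.arr 10 0 = 0) (hy : m₀.arr 9 0 = y) :
    Terminates (forLoop 3 excessStep) m₀ (k * (excessStep.cost + 10) + 6) fun m =>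
      Env k u a₀ t L m ∧ (∀ i < k, m.arr 2 i = excess L y (u i)) ∧
      m.arr 10 0 = ∑ i ∈ Finset.range k, Real.exp (u i - excess L y (u i)) := by
  let I : ℕ → Memory → Prop := fun j m => Env k u a₀ t L m ∧ m.idx 3 = j ∧ m.arr 9 0 = y ∧
    (∀ i < j, m.arr 2 i = excess L y (u i)) ∧
    m.arr 10 0 = ∑ i ∈ Finset.range j, Real.exp (u i - excess L y (u i))
  refine (Terminates.forLoop I (fun i m h => ⟨h.1.idx_zero, h.2.1⟩) (fun j hj m hm => ?_) ?_).mono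
      le_rfl fun m h => ⟨h.1, h.2.2.2⟩
  · obtain ⟨⟨h0, h1, h2, h3, h4⟩, h5, h6, h7, h8⟩ := hm
    refine Program.Straight.terminates ?_
    have H : ∀ i < j + 1, Function.update (m.arr 2) j (excess L y (u j)) i = excess L y (u i) := by
      intro i hi
      rcases (Nat.lt_succ_iff_lt_or_eq.1 hi) with hi | rfl
      · rw [Function.update_of_ne hi.ne, h7 i hi]
      · simp
    rcases excess_cases hL y (u j) with ⟨hc, m1, m2⟩ | ⟨hc, m1, m2⟩ | ⟨hc, hc', m1, m2⟩
    · have he : excess L y (u j) = u j - L - y := by rw [excess, m1, m2, add_zero]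
      have c1 : ¬ u j ≤ y := by linarith
      have c2 : ¬ u j - L ≤ y := by linarith
      simp [excessStep, Program.Straight, setScalar, scalar, utility, Test.Holds, IdxExpr.eval,
        RealExpr.eval, Memory.setIdx, Memory.setCell, I, Finset.sum_range_succ, *] at H ⊢
      exact ⟨⟨by simpa, by simpa, by simpa, by simpa, by simpa⟩, H⟩
    · have he : excess L y (u j) = u j - y := by rw [excess, m1, m2, zero_add]
      have c1 : u j ≤ y := hc.le
      have c2 : u j - L ≤ y := by linarith
      simp [excessStep, Program.Straight, setScalar, scalar, utility, Test.Holds, IdxExpr.eval,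
        RealExpr.eval, Memory.setIdx, Memory.setCell, I, Finset.sum_range_succ, *] at H ⊢
      exact ⟨⟨by simpa, by simpa, by simpa, by simpa, by simpa⟩, H⟩
    · have he : excess L y (u j) = 0 := by rw [excess, m1, m2, zero_add]
      have c2 : u j - L ≤ y := by linarith
      -- When `u j = y` the program takes the lower branch and stores `u j - y`, which is the
      -- correct excess `0`.
      by_cases c1 : u j ≤ y
      · have c3 : u j - y = 0 := by linarith
        simp [excessStep, Program.Straight, setScalar, scalar, utility, Test.Holds, IdxExpr.eval,
          RealExpr.eval, Memory.setIdx, Memory.setCell, I, Finset.sum_range_succ, *] at H ⊢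
        exact ⟨⟨by simpa, by simpa, by simpa, by simpa, by simpa⟩, H⟩
      · clear hc
        simp [excessStep, Program.Straight, setScalar, scalar, utility, Test.Holds, IdxExpr.eval,
          RealExpr.eval, Memory.setIdx, Memory.setCell, I, Finset.sum_range_succ, *] at H ⊢
        exact ⟨⟨by simpa, by simpa, by simpa, by simpa, by simpa⟩, H⟩
  · obtain ⟨e0, e1, e2, e3, e4⟩ := h
    exact ⟨⟨e0, e1, e2, e3, e4⟩, h3, hy, by simp, by simpa⟩

theorem price_terminates {m₀ : Memory} {k : ℕ} {u : ℕ → ℝ} {a₀ t L l : ℝ} {e : ℕ → ℝ}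
    (h : Env k u a₀ t L m₀) (he : ∀ i < k, m₀.arr 2 i = e i)
    (hl : lambertW (m₀.arr 10 0 / (Real.exp 1 * a₀)) = l) :
    Terminates (.seq revenueStep (forLoop 3 priceStep)) m₀
      (revenueStep.cost + (k * (priceStep.cost + 10) + 6)) fun m =>
      (∀ i < k, m.arr 2 i = e i + l + 1) ∧ m.arr 3 0 = l := by
  -- Prices overwrite excesses in place, so the invariant also records that the cells from `j` on
  -- still hold excesses.
  let I : ℕ → Memory → Prop := fun j m => m.idx 0 = k ∧ m.idx 3 = j ∧ m.arr 3 0 = l ∧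
    (∀ i < j, m.arr 2 i = e i + l + 1) ∧ ∀ i < k, j ≤ i → m.arr 2 i = e i
  refine (Program.Straight.terminates (Q := I 0) ?_).seq fun m hm =>
    (Terminates.forLoop I (fun i m h => ⟨h.1, h.2.1⟩) (fun j hj m hm => ?_) hm).mono
      le_rfl fun m h => ⟨h.2.2.2.1, h.2.2.1⟩
  · obtain ⟨h0, h1, h2, h3, h4⟩ := h
    simp [revenueStep, Program.Straight, setScalar, scalar, IdxExpr.eval, RealExpr.eval,
      Memory.setIdx, Memory.setCell, I, *]
    exact he
  · obtain ⟨h0, h1, h2, h3, h4⟩ := hm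
    refine Program.Straight.terminates ?_
    simp [priceStep, Program.Straight, scalar, IdxExpr.eval, RealExpr.eval, Memory.setIdx,
      Memory.setCell, I, *]
    refine ⟨fun i hi => ?_, fun i hi hji => ?_⟩
    · rcases hi.lt_or_eq with hi | rfl
      · rw [Function.update_of_ne hi.ne, h3 i hi]
      · simp
    · rw [Function.update_of_ne (by omega), h4 i hi (by omega)]

theorem solve_correct (n : ℕ) (u : Fin n → ℝ) (a₀ t : ℝ) (k : ℕ) (hk : k ≤ n) (hu : Antitone u)
    (ha : 0 < a₀) (ht : 0 < t) (hk0 : 0 < k) :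
    ∃ (m : Memory) (T : ℕ), Run solve (inputMemory u a₀ t k) m T ∧
      T ≤ (5000 * (Polynomial.X + 1) ^ 2 : Polynomial ℕ).eval k ∧
      IsOptimalPricing (fun i : Fin k => u (Fin.castLE hk i)) a₀ t (outputPrices m k) ∧
      outputRevenue m = revenue (fun i : Fin k => u (Fin.castLE hk i)) a₀ (outputPrices m k) := by
  set U : ℕ → ℝ := fun i => if h : i < n then u ⟨i, h⟩ else 0 with hU
  have hUu : ∀ i : Fin k, U i = u (Fin.castLE hk i) := fun i => dif_pos (i.2.trans_le hk)
  set L := Real.log (1 + t) with hL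
  have hL0 : 0 ≤ L := Real.log_nonneg (by linarith)
  have hmin : ∀ i < k, U (k - 1) ≤ U i := by
    intro i hi
    simp only [hU]
    rw [dif_pos (by omega), dif_pos (by omega)]
    exact hu (by simp only [Fin.mk_le_mk]; omega)
  have hrun := (search_terminates (m₀ := inputMemory u a₀ t k) (u := U) (a₀ := a₀) ht hk0
    (by simp [inputMemory]) (by simp [inputMemory]) (by simp [inputMemory, hU]) hmin
    (by simp [inputMemory]) (by simp [inputMemory])).seq fun m₁ h₁ =>
      (newtonStep_terminates hL0 h₁.1 rfl).seq fun m₂ h₂ =>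
      (excess_terminates (y := m₂.arr 9 0) hL0 h₂.1 h₂.2.1 h₂.2.2.1 rfl).seq
        -- The zero and the level are quantified existentially because they are read off
        -- intermediate memories that the final statement cannot mention.
        (Q := fun m => ∃ y l, balance (1 + t) L U k y = 0 ∧
          l = lambertW ((∑ i ∈ Finset.range k, Real.exp (U i - excess L y (U i))) /
            (Real.exp 1 * a₀)) ∧
          (∀ i < k, m.arr 2 i = excess L y (U i) + l + 1) ∧ m.arr 3 0 = l) fun m₃ h₃ =>
      (price_terminates h₃.1 h₃.2.1 rfl).mono le_rfl fun m h => by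
        refine ⟨m₂.arr 9 0, _, ?_, rfl, ?_⟩
        · rw [h₂.2.2.2]
          exact h₁.2
        · rwa [← h₃.2.2]
  obtain ⟨m, T, hr, hT, y, l, hy, hl, hp, hm⟩ := hrun
  refine ⟨m, T, hr, hT.trans ?_, ?_⟩
  -- All program costs unfold to numerals, leaving a quadratic in `k`; the constant `5000` is
  -- generous.
  · simp only [Polynomial.eval_mul, Polynomial.eval_pow, Polynomial.eval_add, Polynomial.eval_X,
      Polynomial.eval_one, Polynomial.eval_ofNat]
    simp only [considerCost, Program.cost, searchInit, balanceInit, balanceStep, updateBest,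
      excessStep, revenueStep, priceStep, setScalar, scalar, utility, factor, Test.cost,
      RealExpr.cost, IdxExpr.cost]
    ring_nf
    nlinarith
  · have hu' : Antitone fun i : Fin k => u (Fin.castLE hk i) := fun i j hij => hu (by simpa using hij)
    have hbal : ∑ i : Fin k, ((1 + t) * max (u (Fin.castLE hk i) - L - y) 0 +
        min (u (Fin.castLE hk i) - y) 0) = 0 := by
      simp only [← hUu]
      rwa [balance, Finset.sum_range] at hy
    have hl' : l = lambertW ((∑ i : Fin k, Real.exp (u (Fin.castLE hk i) -
        excess L y (u (Fin.castLE hk i)))) / (Real.exp 1 * a₀)) := by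
      simp only [← hUu]
      rwa [Finset.sum_range] at hl
    rw [show outputRevenue m = l from hm]
    exact isOptimalPricing_of_balanced hu' ha ht hL hbal hl' fun i => by
      rw [← hUu]
      exact hp i i.2

end ThresholdLuce

theorem mainTheorem5 :
    ∃ (c : ThresholdLuce.Program) (P : Polynomial ℕ),
      ∀ (n : ℕ) (u : Fin n → ℝ) (a₀ t : ℝ) (k : ℕ) (hk : k ≤ n),
        Antitone u → 0 < a₀ → 0 < t → 0 < k →
          ∃ (m : ThresholdLuce.Memory) (T : ℕ),
            ThresholdLuce.Run c (ThresholdLuce.inputMemory u a₀ t k) m T ∧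
            T ≤ P.eval k ∧
            ThresholdLuce.IsOptimalPricing (fun i : Fin k => u (Fin.castLE hk i)) a₀ t
              (ThresholdLuce.outputPrices m k) ∧
            ThresholdLuce.outputRevenue m =
              ThresholdLuce.revenue (fun i : Fin k => u (Fin.castLE hk i)) a₀
                (ThresholdLuce.outputPrices m k) := by
  exact ⟨ThresholdLuce.solve, 5000 * (Polynomial.X + 1) ^ 2, ThresholdLuce.solve_correct⟩
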